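/- **Proposition 5.2.** For nonzero integers $n_1,\dots,n_k$ let $J(n_1,\dots,n_k)=C[n_1,-n_2,\dots,(-1)^{k+1}n_k]$ be the Conway diagram with four vertical strands $1,2,3,4$: at the top two bridges join strands $1,2$ and strands $3,4$; below them the $i$-th block consists of $|n_i|$ half twists of strands $2,3$ ($i$ odd) or $1,2$ ($i$ even), of handedness given by the sign of $n_i$; at the bottom arcs join $1,2$ and $3,4$ ($k$ odd), or $1,4$ and $2,3$ ($k$ even). In a positive crossing the over-strand passes between top right and bottom left, in a negative one between top left and bottom right. Suppose that this diagram represents a knot $K$ (every 2-bridge knot has such diagrams), with a chosen orientation. On $R^2$ ($R$ a commutative ring) put $\langle x,y\rangle=x_1y_2-x_2y_1$. Colour the strands by vectors, from top to bottom, starting with $a=(1,0)^T$ on the left top bridge and $b=(0,u)^T$ on the right one, so that $\langle a,b\rangle=u$. At a crossing the over-strand keeps its vector $y$, and the vector $x$ of the under-strand becomes $-(x+\varepsilon\langle x,y\rangle y)$, where $\varepsilon=\pm1$ is as follows: at a positive crossing $\varepsilon=1$ if and only if the over-strand is oriented downwards, at a negative crossing $\varepsilon=1$ if and only if it is oriented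 upwards. Strand $4$ always carries $b$. Let $v\in\mathbb Z[u]^2$ be the final vector of the strand joined to strand $4$ at the bottom. The *rep-polynomial* $P_K(u)\in\mathbb Z[u]$ of the diagram is $\pm\langle v,b\rangle$, with the sign that makes its leading coefficient positive. Let $r\in\mathbb C$, $r\ne0$, be a root of $P_K(u)$. Then there is exactly one representation $\rho:G(K)\to SL(2,\mathbb C)$ of the knot group (given by the Wirtinger presentation of the diagram) that sends the meridian of each arc to $$I+\begin{pmatrix}v_1\\v_2\end{pmatrix}(-v_2,\;v_1),$$ where $(v_1,v_2)^T$ is the vector of the arc in the colouring with $u=r$; this is the parabolic representation corresponding to $r$. Its trace field $\mathbb Q(\operatorname{tr}\rho(\gamma)\mid\gamma\in G(K))$ equals $\mathbb Q(r^2)$, the root $r$ belongs to this field, and $r$ is a unit of its ring of algebraic integers. -/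

import Mathlib

/-!
Two-bridge diagrams. A sequence `n = [n₁, …, n_k]` of nonzero integers describes the diagram
`J(n₁, …, n_k) = C[n₁, -n₂, n₃, …, (-1)^(k+1) n_k]` (Conway normal form): four vertical strands
`0, 1, 2, 3`, joined at the top by the two bridges `0-1` and `2-3`; below them the blocks of
crossings, the `i`-th block consisting of `|n_i|` half twists between the strands `1, 2` if `i` is
odd and between the strands `0, 1` if `i` is even, right- or left-handed according to the sign
of `n_i`; at the bottom the strands are joined by the arcs `0-1`, `2-3` if `k` is odd and
by the arcs `0-3`, `1-2` if `k` is even.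
-/

namespace TwoBridge

/-- A crossing between the neighbouring strands in the positions `left` and `right`.
If `positive` holds, the over-strand runs between top right and bottom left, otherwise it runs
between top left and bottom right. -/
structure Crossing where
  left : Fin 4
  right : Fin 4
  positive : Bool

/-- The crossings of consecutive blocks, from top to bottom; the flag says whether the first of
these blocks lies between the strands `1, 2` (an odd block) or `0, 1` (an even block). -/
def blocks : Bool → List ℤ → List Crossing
  | _, [] => []
  | true, m :: ns => List.replicate m.natAbs ⟨1, 2, decide (0 < m)⟩ ++ blocks false ns
  | false, m :: ns => List.replicate m.natAbs ⟨0, 1, decide (0 < m)⟩ ++ blocks true ns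

/-- All crossings of the diagram `J(n₁, …, n_k)`, from top to bottom. -/
def crossings (n : List ℤ) : List Crossing := blocks true n

/-- The number of crossings. Horizontal lines between the crossings cut the diagram at the levels
`0, …, height n`; level `0` is just below the top bridges. -/
def height (n : List ℤ) : ℕ := (crossings n).length

/-- The effect of a crossing on decorations `s` of the four strands. The over-strand keeps its
decoration. The decoration `x` of the under-strand becomes `act ε y x`, where `y` is the decoration
of the over-strand and `ε` is the sign with which `y` acts. Here `o p = 1` if strand `p` is
oriented downwards and `o p = -1` if it is oriented upwards. -/
def cross {S : Type*} (act : ℤˣ → S → S → S) (o : Fin 4 → ℤˣ) (c : Crossing) (s : Fin 4 → S) :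
    Fin 4 → S := fun p =>
  if c.positive then
    if p = c.left then s c.right
    else if p = c.right then act (o c.right) (s c.right) (s c.left)
    else s p
  else
    if p = c.right then s c.left
    else if p = c.left then act (-o c.left) (s c.left) (s c.right)
    else s p

/-- Decorations that simply travel along the strands: given their values `s` at the top, their
values at level `j`. -/
def carry {S : Type*} (n : List ℤ) (s : Fin 4 → S) : ℕ → Fin 4 → S
  | 0 => s
  | j + 1 =>
    match (crossings n)[j]? with
    | none => carry n s j
    | some c => cross (fun _ _ x => x) (fun _ => 1) c (carry n s j)

/-- The strand to which a strand is joined at the top. -/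
def topMate : Fin 4 → Fin 4 := ![1, 0, 3, 2]

/-- The strand to which a strand is joined at the bottom. -/
def bottomMate (n : List ℤ) : Fin 4 → Fin 4 :=
  if n.length % 2 = 1 then ![1, 0, 3, 2] else ![3, 2, 1, 0]

/-- The diagram represents a knot (has one component): the two strands meeting in a bottom
arc hang from different top bridges. The label of a strand is the bridge (`0` or `1`) from
which it hangs. -/
def IsKnot (n : List ℤ) : Prop :=
  ∀ p, carry n (![0, 0, 1, 1] : Fin 4 → Fin 2) (height n) (bottomMate n p) ≠
    carry n (![0, 0, 1, 1] : Fin 4 → Fin 2) (height n) p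

/-- The directions `o` of the four strands at the top (`1` down, `-1` up) extend to an
orientation of the diagram: strands that are joined run in opposite vertical directions. -/
def IsOrientation (n : List ℤ) (o : Fin 4 → ℤˣ) : Prop :=
  (∀ p, o (topMate p) = -o p) ∧
    ∀ p, carry n o (height n) (bottomMate n p) = -carry n o (height n) p

/-! ### Arc colorings by the symplectic quandle -/

/-- The symplectic form `⟨x, y⟩ = x₁ y₂ - x₂ y₁` on `R²`. -/
def form {R : Type*} [CommRing R] (x y : Fin 2 → R) : R := x 0 * y 1 - x 1 * y 0

/-- The action at a crossing: `-(x ▷ y) = -(x + ⟨x, y⟩ y)` if `ε = 1` and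
`-(x ▷⁻¹ y) = -(x - ⟨x, y⟩ y)` if `ε = -1`. -/
def vecAct {R : Type*} [CommRing R] (ε : ℤˣ) (y x : Fin 2 → R) : Fin 2 → R :=
  -(x + (((ε : ℤ) : R) * form x y) • y)

/-- The arc vectors at level `j`, starting from the vectors `a = (1, 0)` and `b = (0, u)` on the
two top bridges, so that `⟨a, b⟩ = u`. -/
def arcVec {R : Type*} [CommRing R] (n : List ℤ) (o : Fin 4 → ℤˣ) (u : R) :
    ℕ → Fin 4 → Fin 2 → R
  | 0 => ![![1, 0], ![1, 0], ![0, u], ![0, u]]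
  | j + 1 =>
    match (crossings n)[j]? with
    | none => arcVec n o u j
    | some c => cross vecAct (carry n o j) c (arcVec n o u j)

/-- The polynomial `⟨b_{k,f}, b⟩` (`k` odd) or `⟨a_{k,f}, b⟩` (`k` even) in the
indeterminate `u`: the form of the two arc vectors that meet in the bottom arc at strand `3`
(which always carries `b`). -/
noncomputable def closingPoly (n : List ℤ) (o : Fin 4 → ℤˣ) : Polynomial ℤ :=
  form (arcVec n o (Polynomial.X : Polynomial ℤ) (height n) (bottomMate n 3))
    (arcVec n o (Polynomial.X : Polynomial ℤ) (height n) 3)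

/-- The rep-polynomial `P_K(u)`: the closing polynomial, with the sign chosen so that the
leading coefficient is positive. -/
noncomputable def repPoly (n : List ℤ) (o : Fin 4 → ℤˣ) : Polynomial ℤ :=
  Polynomial.C (closingPoly n o).leadingCoeff.sign * closingPoly n o

/-! ### The knot group and its representations -/

/-- Conjugation of `x` by `y`: `y⁻¹ x y` if `ε = 1` and `y x y⁻¹` if `ε = -1`. -/
def conjAct {G : Type*} [Group G] (ε : ℤˣ) (y x : G) : G :=
  y ^ (-(ε : ℤ)) * x * y ^ (ε : ℤ)

/-- The segments into which the horizontal lines cut the strands (level, position). -/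
abbrev Seg (n : List ℤ) : Type := Fin (height n + 1) × Fin 4

/-- Wirtinger relators of the oriented diagram; one generator for every segment. -/
def wirtingerRels (n : List ℤ) (o : Fin 4 → ℤˣ) : Set (FreeGroup (Seg n)) :=
  {x | ∃ p, x = FreeGroup.of (0, topMate p) * (FreeGroup.of (0, p))⁻¹} ∪
  {x | ∃ (j : Fin (height n)) (p : Fin 4), x = FreeGroup.of (j.succ, p) *
    (cross conjAct (carry n o j) ((crossings n).get j)
      (fun q => FreeGroup.of (j.castSucc, q)) p)⁻¹} ∪
  {x | ∃ p, x = FreeGroup.of (Fin.last _, bottomMate n p) * (FreeGroup.of (Fin.last _, p))⁻¹}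

/-- The knot group `G(K)`, by its Wirtinger presentation. -/
abbrev KnotGroup (n : List ℤ) (o : Fin 4 → ℤˣ) : Type := PresentedGroup (wirtingerRels n o)

/-- The meridian of a segment. -/
def meridian (n : List ℤ) (o : Fin 4 → ℤˣ) (s : Seg n) : KnotGroup n o :=
  PresentedGroup.of s

/-- The matrix `I + v v̂` with `v̂ = (-v₂, v₁)`: the matrix of determinant `1` and trace `2`
that corresponds to the vector `±v`. -/
noncomputable def parabolicMatrix (v : Fin 2 → ℂ) : Matrix (Fin 2) (Fin 2) ℂ :=
  1 + Matrix.vecMulVec v ![-v 1, v 0]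

/-- `ρ` is the parabolic representation corresponding to `r`: it sends the meridian of each arc
to the matrix of the arc vector, for the arc coloring with `a = (1, 0)` and `b = (0, r)`. -/
def CorrespondsTo (n : List ℤ) (o : Fin 4 → ℤˣ) (r : ℂ)
    (ρ : KnotGroup n o →* Matrix.SpecialLinearGroup (Fin 2) ℂ) : Prop :=
  ∀ s : Seg n, (ρ (meridian n o s) : Matrix (Fin 2) (Fin 2) ℂ) =
    parabolicMatrix (arcVec n o r s.1 s.2)

/-- The trace field `ℚ(tr ρ(γ) | γ ∈ G)` of a representation. -/
noncomputable def traceField {G : Type*} [Group G] (ρ : G →* Matrix.SpecialLinearGroup (Fin 2) ℂ) :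
    IntermediateField ℚ ℂ :=
  IntermediateField.adjoin ℚ
    {z | ∃ γ : G, z = (ρ γ : Matrix (Fin 2) (Fin 2) ℂ).trace}

end TwoBridge

/-! The forms ⟨xᵢ, xⱼ⟩ of the four arc vectors on a horizontal line are followed down the diagram.
By `FormRelations`, which crossings preserve, four of them suffice up to sign: s = ⟨x₁, x₂⟩, t =
⟨x₀, x₁⟩, w = ⟨x₀, x₂⟩, v = ⟨x₁, x₃⟩, with ±v ± w = -st and vw = ±s² ± t². For the indeterminate `X`
their degrees are |p|, |q|, |p + q|, |p - q| with p, q coprime, and nonzero forms have leading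
coefficient ±1 (`HasSlope.cross`). For a knot the closing form has an odd label, so the
rep-polynomial is monic and r is an algebraic integer.

At a root the closing form vanishes, and the same relations force the vectors meeting in each bottom
arc to agree up to sign (`arcVec_bottomMate`). Since v ↦ I + v v̂ forgets the sign and turns the
vector action into conjugation, the Wirtinger relations hold.

The image is generated by the matrices of the two bridges, which have entries in ℤ[r²] and whose
product has trace 2 - r²; hence the trace field is ℚ(r²). For a knot the bridge meridians are
conjugate, and a conjugating matrix g satisfies (r g₀₁)² = 1 (`CorrespondsTo.exists_mul_eq_one`). So
r⁻¹ = ±g₀₁ lies in ℤ[r²], which puts r into the field and makes r⁻¹ integral. -/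

namespace TwoBridge

open Polynomial

/-! ### Single crossings -/

section General

theorem crossing_mem_blocks {c : Crossing} : ∀ (f : Bool) (n : List ℤ), c ∈ blocks f n →
    (c.left = 1 ∧ c.right = 2) ∨ (c.left = 0 ∧ c.right = 1)
  | _, [], h => by simp [blocks] at h
  | true, m :: ns, h => by
    simp only [blocks, List.mem_append, List.mem_replicate] at h
    rcases h with ⟨-, rfl⟩ | h
    · exact Or.inl ⟨rfl, rfl⟩
    · exact crossing_mem_blocks _ _ h
  | false, m :: ns, h => by
    simp only [blocks, List.mem_append, List.mem_replicate] at h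
    rcases h with ⟨-, rfl⟩ | h
    · exact Or.inr ⟨rfl, rfl⟩
    · exact crossing_mem_blocks _ _ h

theorem crossing_cases {n : List ℤ} {j : ℕ} {c : Crossing} (h : (crossings n)[j]? = some c) :
    c = ⟨1, 2, true⟩ ∨ c = ⟨1, 2, false⟩ ∨ c = ⟨0, 1, true⟩ ∨ c = ⟨0, 1, false⟩ := by
  obtain ⟨l, r, b⟩ := c
  have := crossing_mem_blocks true n (List.mem_of_getElem? h)
  simp only at this
  rcases this with ⟨rfl, rfl⟩ | ⟨rfl, rfl⟩ <;> cases b <;> simp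

/-- Naturality: ring maps, group homomorphisms and the passage from vectors to matrices can all be
pushed through a crossing. -/
theorem cross_map {S T : Type*} {act : ℤˣ → S → S → S} {act' : ℤˣ → T → T → T} (φ : S → T)
    (h : ∀ ε y x, φ (act ε y x) = act' ε (φ y) (φ x)) (o : Fin 4 → ℤˣ) (c : Crossing)
    (s : Fin 4 → S) (p : Fin 4) :
    φ (cross act o c s p) = cross act' o c (fun q => φ (s q)) p := by
  unfold cross
  split_ifs <;> simp [h]

variable {S : Type*} (act : ℤˣ → S → S → S) (o : Fin 4 → ℤˣ) (s : Fin 4 → S)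

theorem cross_middle_pos : cross act o ⟨1, 2, true⟩ s = ![s 0, s 2, act (o 2) (s 2) (s 1), s 3] := by
  funext p; fin_cases p <;> simp [cross]

theorem cross_middle_neg :
    cross act o ⟨1, 2, false⟩ s = ![s 0, act (-o 1) (s 1) (s 2), s 1, s 3] := by
  funext p; fin_cases p <;> simp [cross]

theorem cross_left_pos : cross act o ⟨0, 1, true⟩ s = ![s 1, act (o 1) (s 1) (s 0), s 2, s 3] := by
  funext p; fin_cases p <;> simp [cross]

theorem cross_left_neg :
    cross act o ⟨0, 1, false⟩ s = ![act (-o 0) (s 0) (s 1), s 0, s 2, s 3] := by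
  funext p; fin_cases p <;> simp [cross]

variable {n : List ℤ} {j : ℕ}

theorem carry_succ_none (h : (crossings n)[j]? = none) : carry n s (j + 1) = carry n s j := by
  simp only [carry, h]

theorem carry_succ_some {c : Crossing} (h : (crossings n)[j]? = some c) :
    carry n s (j + 1) = cross (fun _ _ x => x) (fun _ => 1) c (carry n s j) := by
  simp only [carry, h]

theorem arcVec_succ_none {R : Type*} [CommRing R] (u : R) (h : (crossings n)[j]? = none) :
    arcVec n o u (j + 1) = arcVec n o u j := by
  simp only [arcVec, h]

theorem arcVec_succ_some {R : Type*} [CommRing R] (u : R) {c : Crossing}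
    (h : (crossings n)[j]? = some c) :
    arcVec n o u (j + 1) = cross vecAct (carry n o j) c (arcVec n o u j) := by
  simp only [arcVec, h]

end General

/-! ### Relations between the forms on a horizontal line -/

section Forms

variable {R : Type*} [CommRing R]

theorem form_self (x : Fin 2 → R) : form x x = 0 := by simp only [form]; ring

theorem form_swap (x y : Fin 2 → R) : form y x = -form x y := by simp only [form]; ring

theorem form_vecAct_right (ε : ℤˣ) (x y z : Fin 2 → R) :
    form z (vecAct ε y x) = -(form z x + ((ε : ℤ) : R) * form x y * form z y) := by
  simp [form, vecAct]; ring

theorem form_vecAct_left (ε : ℤˣ) (x y z : Fin 2 → R) :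
    form (vecAct ε y x) z = -(form x z + ((ε : ℤ) : R) * form x y * form y z) := by
  simp [form, vecAct]; ring

theorem form_plucker (x y z w : Fin 2 → R) :
    form x y * form z w - form x z * form y w + form x w * form y z = 0 := by
  simp only [form]; ring

theorem unit_cast_sq (ε : ℤˣ) : ((ε : ℤ) : R) * ((ε : ℤ) : R) = 1 := by
  rcases Int.units_eq_one_or ε with rfl | rfl <;> simp

/-- The relations between the forms of the four arc vectors on a horizontal line, which say that
the product of the four meridians is trivial. -/
structure FormRelations (κ : ℤˣ) (o : Fin 4 → ℤˣ) (x : Fin 4 → Fin 2 → R) : Prop where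
  outer : form (x 0) (x 3) = ((κ : ℤ) : R) * ((o 0 : ℤ) : R) * form (x 1) (x 2)
  right : form (x 2) (x 3) = ((κ : ℤ) : R) * ((o 2 : ℤ) : R) * form (x 0) (x 1)
  diagonal : ((κ : ℤ) : R) * form (x 1) (x 3) + ((o 1 : ℤ) : R) * form (x 0) (x 2) =
    -(form (x 1) (x 2) * form (x 0) (x 1))

theorem FormRelations.plucker {κ : ℤˣ} {o : Fin 4 → ℤˣ} {x : Fin 4 → Fin 2 → R}
    (h : FormRelations κ o x) : form (x 0) (x 2) * form (x 1) (x 3) =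
      ((κ : ℤ) : R) * (((o 2 : ℤ) : R) * form (x 0) (x 1) ^ 2 +
        ((o 0 : ℤ) : R) * form (x 1) (x 2) ^ 2) := by
  have := form_plucker (x 0) (x 1) (x 2) (x 3)
  rw [h.outer, h.right] at this
  linear_combination -this

/-- For each type of crossing the forms expand bilinearly, and the claims become polynomial
identities modulo the given relations and the fact that signs square to 1. -/
theorem FormRelations.cross {n : List ℤ} {j : ℕ} {c : Crossing} (hc : (crossings n)[j]? = some c)
    {κ : ℤˣ} {o : Fin 4 → ℤˣ} {x : Fin 4 → Fin 2 → R} (h : FormRelations κ o x) :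
    FormRelations κ (cross (fun _ _ x => x) (fun _ => 1) c o) (cross vecAct o c x) := by
  obtain ⟨h1, h2, h3⟩ := h
  have k := unit_cast_sq (R := R) κ
  have e0 := unit_cast_sq (R := R) (o 0)
  have e1 := unit_cast_sq (R := R) (o 1)
  have e2 := unit_cast_sq (R := R) (o 2)
  rcases crossing_cases hc with rfl | rfl | rfl | rfl <;>
  simp only [cross_middle_pos, cross_middle_neg, cross_left_pos, cross_left_neg] <;>
  constructor <;>
  simp only [Matrix.cons_val, form_vecAct_left, form_vecAct_right, form_self, Units.val_neg,
    Int.cast_neg, form_swap (x 1) (x 2), form_swap (x 0) (x 1)] <;>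
  grind

theorem formRelations_arcVec (n : List ℤ) {o : Fin 4 → ℤˣ} (ho : ∀ p, o (topMate p) = -o p) (u : R)
    (j : ℕ) : FormRelations (o 0) (carry n o j) (arcVec n o u j) := by
  induction j with
  | zero =>
    have h : o 1 = -o 0 := ho 0
    have := unit_cast_sq (R := R) (o 0)
    constructor <;> simp [carry, arcVec, form, h, this]
  | succ j ih =>
    cases hc : (crossings n)[j]? with
    | none => rwa [carry_succ_none _ hc, arcVec_succ_none _ _ hc]
    | some c =>
      rw [carry_succ_some _ hc, arcVec_succ_some _ _ hc]
      exact ih.cross hc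

/-- A crossing can be undone, so simultaneous vanishing would travel back up to the top, where ⟨x₁,
x₂⟩ = u. This later supplies a basis of the plane at the bottom. -/
theorem forms_ne_zero (n : List ℤ) (o : Fin 4 → ℤˣ) {u : R} (hu : u ≠ 0) (j : ℕ) :
    ¬(form (arcVec n o u j 1) (arcVec n o u j 2) = 0 ∧
      form (arcVec n o u j 0) (arcVec n o u j 1) = 0 ∧
      form (arcVec n o u j 0) (arcVec n o u j 2) = 0) := by
  induction j with
  | zero => simp [arcVec, form, hu]
  | succ j ih =>
    cases hc : (crossings n)[j]? with
    | none => rwa [arcVec_succ_none _ _ hc]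
    | some c =>
      rw [arcVec_succ_some _ _ hc]
      contrapose! ih
      have e := unit_cast_sq (R := R) (carry n o j 0)
      obtain ⟨i1, i2, i3⟩ := ih
      rcases crossing_cases hc with rfl | rfl | rfl | rfl <;>
      simp only [cross_middle_pos, cross_middle_neg, cross_left_pos, cross_left_neg,
        Matrix.cons_val, form_vecAct_left, form_vecAct_right, form_self, Units.val_neg,
        Int.cast_neg] at i1 i2 i3 <;>
      grind [form_swap]

theorem arcVec_map {R' : Type*} [CommRing R'] (φ : R →+* R') (n : List ℤ) (o : Fin 4 → ℤˣ) (u : R)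
    (j : ℕ) (p : Fin 4) : (fun i => φ (arcVec n o u j p i)) = arcVec n o (φ u) j p := by
  induction j generalizing p with
  | zero => fin_cases p <;> funext i <;> fin_cases i <;> simp [arcVec]
  | succ j ih =>
    cases hc : (crossings n)[j]? with
    | none =>
      rw [arcVec_succ_none _ _ hc, arcVec_succ_none _ _ hc]
      exact ih p
    | some c =>
      rw [arcVec_succ_some _ _ hc, arcVec_succ_some _ _ hc]
      refine (cross_map (act' := vecAct) (fun (v : Fin 2 → R) i => φ (v i)) ?_ _ _ _ _).trans ?_
      · intro ε y x
        funext i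
        simp [vecAct, form]
      · exact congrArg (fun s => cross vecAct (carry n o j) c s p) (funext ih)

end Forms

/-! ### Degrees and leading coefficients of the forms -/

section Degrees

/-- `f` has degree `d` and its leading coefficient is `±1`. -/
def UnitLead (f : ℤ[X]) (d : ℕ) : Prop := f.natDegree = d ∧ IsUnit f.leadingCoeff

theorem UnitLead.ne_zero {f : ℤ[X]} {d : ℕ} (h : UnitLead f d) : f ≠ 0 := by
  rintro rfl
  simpa using h.2

theorem UnitLead.mul {f g : ℤ[X]} {d e : ℕ} (hf : UnitLead f d) (hg : UnitLead g e) :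
    UnitLead (f * g) (d + e) := by
  refine ⟨?_, ?_⟩
  · rw [natDegree_mul hf.ne_zero hg.ne_zero, hf.1, hg.1]
  · rw [leadingCoeff_mul]
    exact hf.2.mul hg.2

theorem unitLead_units (ε : ℤˣ) : UnitLead ((ε : ℤ) : ℤ[X]) 0 := by
  rcases Int.units_eq_one_or ε with rfl | rfl <;> simp [UnitLead]

theorem UnitLead.units_mul {f : ℤ[X]} {d : ℕ} (hf : UnitLead f d) (ε : ℤˣ) :
    UnitLead (((ε : ℤ) : ℤ[X]) * f) d := by
  simpa using (unitLead_units ε).mul hf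

theorem UnitLead.add_of_lt {f g : ℤ[X]} {d : ℕ} (hf : UnitLead f d) (hg : g.natDegree < d) :
    UnitLead (f + g) d := by
  have h := hf.1 ▸ hg
  refine ⟨?_, ?_⟩
  · rw [natDegree_add_eq_left_of_natDegree_lt h, hf.1]
  · rw [leadingCoeff_add_of_degree_lt' (degree_lt_degree h)]
    exact hf.2

theorem UnitLead.of_mul_left {f g : ℤ[X]} {d e : ℕ} (hf : UnitLead f d)
    (h : UnitLead (f * g) (d + e)) : UnitLead g e := by
  have hg : g ≠ 0 := right_ne_zero_of_mul h.ne_zero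
  have h1 := h.1
  have h2 := h.2
  rw [natDegree_mul hf.ne_zero hg, hf.1] at h1
  rw [leadingCoeff_mul] at h2
  exact ⟨by omega, isUnit_of_mul_isUnit_right h2⟩

/-- `f` has a zero at `0`, its degree is `|m|` and its leading coefficient is `±1`; if `m = 0`
then `f = 0`. -/
structure HasLabel (f : ℤ[X]) (m : ℤ) : Prop where
  zero : m = 0 → f = 0
  lead : m ≠ 0 → UnitLead f m.natAbs
  dvd : X ∣ f

theorem HasLabel.congr {f g : ℤ[X]} {m m' : ℤ} (h : HasLabel f m) (hg : g = f)
    (hm : m.natAbs = m'.natAbs) : HasLabel g m' := by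
  subst hg
  exact ⟨fun h' => h.zero (by omega), fun h' => hm ▸ h.lead (by omega), h.dvd⟩

theorem HasLabel.units_mul {f : ℤ[X]} {m : ℤ} (h : HasLabel f m) (ε : ℤˣ) :
    HasLabel (((ε : ℤ) : ℤ[X]) * f) m :=
  ⟨fun h' => by rw [h.zero h', mul_zero], fun h' => (h.lead h').units_mul ε, h.dvd.mul_left _⟩

theorem HasLabel.sq_eq {f : ℤ[X]} {m : ℤ} (h : HasLabel f m) (hm : m.natAbs = 1) :
    f ^ 2 = X ^ 2 := by
  obtain ⟨g, rfl⟩ := h.dvd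
  have hl := h.lead (by omega)
  have hX : UnitLead (X : ℤ[X]) 1 := by simp [UnitLead]
  have hg : UnitLead g 0 := hX.of_mul_left (by simpa [hm] using hl)
  obtain ⟨hd, hu⟩ := hg
  obtain ⟨c, rfl⟩ := natDegree_eq_zero.1 hd
  rw [leadingCoeff_C] at hu
  rcases Int.isUnit_iff.1 hu with rfl | rfl <;> simp

theorem HasLabel.natDegree {f : ℤ[X]} {m : ℤ} (h : HasLabel f m) : f.natDegree = m.natAbs := by
  by_cases hm : m = 0
  · simp [h.zero hm, hm]
  · exact (h.lead hm).1

theorem HasLabel.lead_sq {f : ℤ[X]} {m : ℤ} (h : HasLabel f m) (hm : m ≠ 0) (ε : ℤˣ) :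
    UnitLead (((ε : ℤ) : ℤ[X]) * f ^ 2) (m.natAbs + m.natAbs) := by
  rw [pow_two]
  exact ((h.lead hm).mul (h.lead hm)).units_mul ε

theorem HasLabel.natDegree_sq {f : ℤ[X]} {m : ℤ} (h : HasLabel f m) (ε : ℤˣ) :
    (((ε : ℤ) : ℤ[X]) * f ^ 2).natDegree = m.natAbs + m.natAbs := by
  by_cases hm : m = 0
  · simp [h.zero hm, hm]
  · exact (h.lead_sq hm ε).1

/-- Since |q| + |2p + q| = 2 max(|p|, |p + q|), the quadratic relation gives the degree of w' as
soon as one of the two squares dominates. The degrees of the squares coincide only for q = 0 or 2p +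
q = 0; these cases need the linear relation and divisibility by `X`. -/
theorem HasLabel.step {s t w w' : ℤ[X]} {p q : ℤ} (hpq : IsCoprime p q) (hs : HasLabel s p)
    (ht : HasLabel t q) (hw : HasLabel w (p + q)) (a b c d : ℤˣ)
    (hquad : t * w' = ((a : ℤ) : ℤ[X]) * w ^ 2 + ((b : ℤ) : ℤ[X]) * s ^ 2)
    (hlin : w' = ((c : ℤ) : ℤ[X]) * t + ((d : ℤ) : ℤ[X]) * (s * w))
    {m : ℤ} (hm : (2 * p + q).natAbs = m.natAbs) : HasLabel w' m := by
  refine HasLabel.congr (m := 2 * p + q) ?_ rfl hm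
  have hX : X ∣ w' := by
    rw [hlin]
    exact dvd_add (ht.dvd.mul_left _) ((hs.dvd.mul_right _).mul_left _)
  by_cases hq : q = 0
  · subst hq
    have hp : p.natAbs = 1 := Int.isUnit_iff_natAbs_eq.1 (isCoprime_zero_right.1 hpq)
    -- With t = 0 the quadratic relation says nothing about w', but the linear one reduces to w' =
    -- ±s w.
    rw [ht.zero rfl, mul_zero, zero_add] at hlin
    refine ⟨fun h => by omega, fun _ => ?_, hX⟩
    rw [hlin]
    have := ((hs.lead (by omega)).mul (hw.lead (by omega))).units_mul d
    rwa [show p.natAbs + (p + 0).natAbs = (2 * p + 0).natAbs by omega] at this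
  have hl := ht.lead hq
  by_cases h2 : 2 * p + q = 0
  · have hp : p.natAbs = 1 := by
      obtain rfl : q = p * (-2) := by omega
      exact Int.isUnit_iff_natAbs_eq.1 (isCoprime_self.1 (IsCoprime.of_mul_right_left hpq))
    rw [hs.sq_eq hp, hw.sq_eq (by omega)] at hquad
    have hz : w' = 0 := by
      -- Here t has degree 2 and a nonzero w' has degree at least 1 because of its factor `X`,
      -- whereas t w' = ±X² ± X² has degree at most 2.
      by_contra hne
      have h3 := natDegree_mul hl.ne_zero hne
      have h4 : (((a : ℤ) : ℤ[X]) * X ^ 2 + ((b : ℤ) : ℤ[X]) * X ^ 2).natDegree ≤ 2 := by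
        compute_degree
      have h5 := natDegree_le_of_dvd hX hne
      rw [hquad, hl.1] at h3
      rw [natDegree_X] at h5
      omega
    exact ⟨fun _ => hz, fun h => absurd h2 h, hX⟩
  · refine ⟨fun h => absurd h h2, fun _ => hl.of_mul_left ?_, hX⟩
    rw [hquad]
    rcases lt_or_gt_of_ne (show (p + q).natAbs ≠ p.natAbs by omega) with h | h
    · rw [add_comm, show q.natAbs + (2 * p + q).natAbs = p.natAbs + p.natAbs by omega]
      refine (hs.lead_sq (by omega) b).add_of_lt ?_
      rw [hw.natDegree_sq]
      omega
    · rw [show q.natAbs + (2 * p + q).natAbs = (p + q).natAbs + (p + q).natAbs by omega]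
      refine (hw.lead_sq (by omega) a).add_of_lt ?_
      rw [hs.natDegree_sq]
      omega

/-- The degrees of the forms of the arc vectors `x` on a horizontal line are given by a pair of
coprime integers; modulo `2`, these integers record the bridges `l` from which the strands hang. -/
structure HasSlope (l : Fin 4 → Fin 2) (x : Fin 4 → Fin 2 → ℤ[X]) (p q : ℤ) : Prop where
  coprime : IsCoprime p q
  middle : HasLabel (form (x 1) (x 2)) p
  left : HasLabel (form (x 0) (x 1)) q
  even : HasLabel (form (x 0) (x 2)) (p + q)
  odd : HasLabel (form (x 1) (x 3)) (p - q)
  parity_zero : l 0 = l 3 ↔ Even p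
  parity_one : l 1 = l 3 ↔ Even (p + q)
  parity_two : l 2 = l 3 ↔ Even q

/-- An exchange relation: the second factor on the left is the form that a crossing creates. The
form ⟨x₁, x₃⟩ is eliminated between the diagonal and the Plücker relation. The next three lemmas
serve the other types of crossing. -/
theorem FormRelations.mul_left {R : Type*} [CommRing R] {κ : ℤˣ} {o : Fin 4 → ℤˣ}
    {x : Fin 4 → Fin 2 → R} (h : FormRelations κ o x) :
    form (x 0) (x 1) *
      -(form (x 0) (x 1) + ((o 2 : ℤ) : R) * form (x 1) (x 2) * form (x 0) (x 2)) =
    ((o 2 : ℤ) : R) * ((o 1 : ℤ) : R) * form (x 0) (x 2) ^ 2 +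
      ((o 2 : ℤ) : R) * ((o 0 : ℤ) : R) * form (x 1) (x 2) ^ 2 := by
  linear_combination -((o 2 : ℤ) : R) * form (x 0) (x 2) * h.diagonal +
    ((o 2 : ℤ) : R) * ((κ : ℤ) : R) * h.plucker +
    (((o 2 : ℤ) : R) ^ 2 * form (x 0) (x 1) ^ 2 +
      ((o 2 : ℤ) : R) * ((o 0 : ℤ) : R) * form (x 1) (x 2) ^ 2) * unit_cast_sq (R := R) κ +
    form (x 0) (x 1) ^ 2 * unit_cast_sq (R := R) (o 2)

theorem FormRelations.mul_middle {R : Type*} [CommRing R] {κ : ℤˣ} {o : Fin 4 → ℤˣ}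
    {x : Fin 4 → Fin 2 → R} (h : FormRelations κ o x) :
    form (x 1) (x 2) *
      -(form (x 1) (x 2) + ((o 0 : ℤ) : R) * form (x 0) (x 1) * form (x 0) (x 2)) =
    ((o 0 : ℤ) : R) * ((o 1 : ℤ) : R) * form (x 0) (x 2) ^ 2 +
      ((o 0 : ℤ) : R) * ((o 2 : ℤ) : R) * form (x 0) (x 1) ^ 2 := by
  linear_combination -((o 0 : ℤ) : R) * form (x 0) (x 2) * h.diagonal +
    ((o 0 : ℤ) : R) * ((κ : ℤ) : R) * h.plucker +
    (((o 0 : ℤ) : R) ^ 2 * form (x 1) (x 2) ^ 2 +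
      ((o 0 : ℤ) : R) * ((o 2 : ℤ) : R) * form (x 0) (x 1) ^ 2) * unit_cast_sq (R := R) κ +
    form (x 1) (x 2) ^ 2 * unit_cast_sq (R := R) (o 0)

theorem FormRelations.mul_right {R : Type*} [CommRing R] {κ : ℤˣ} {o : Fin 4 → ℤˣ}
    {x : Fin 4 → Fin 2 → R} (h : FormRelations κ o x) :
    form (x 0) (x 1) *
      -(form (x 2) (x 3) + ((o 1 : ℤ) : R) * form (x 1) (x 2) * form (x 1) (x 3)) =
    ((κ : ℤ) : R) * ((o 1 : ℤ) : R) * form (x 1) (x 3) ^ 2 +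
      ((κ : ℤ) : R) * ((o 0 : ℤ) : R) * form (x 1) (x 2) ^ 2 := by
  linear_combination -form (x 0) (x 1) * h.right -
    ((o 1 : ℤ) : R) * form (x 1) (x 3) * h.diagonal + h.plucker +
    form (x 0) (x 2) * form (x 1) (x 3) * unit_cast_sq (R := R) (o 1)

theorem FormRelations.mul_outer {R : Type*} [CommRing R] {κ : ℤˣ} {o : Fin 4 → ℤˣ}
    {x : Fin 4 → Fin 2 → R} (h : FormRelations κ o x) :
    form (x 1) (x 2) *
      -(form (x 0) (x 3) + ((o 1 : ℤ) : R) * form (x 0) (x 1) * form (x 1) (x 3)) =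
    ((κ : ℤ) : R) * ((o 1 : ℤ) : R) * form (x 1) (x 3) ^ 2 +
      ((κ : ℤ) : R) * ((o 2 : ℤ) : R) * form (x 0) (x 1) ^ 2 := by
  linear_combination -form (x 1) (x 2) * h.outer -
    ((o 1 : ℤ) : R) * form (x 1) (x 3) * h.diagonal + h.plucker +
    form (x 0) (x 2) * form (x 1) (x 3) * unit_cast_sq (R := R) (o 1)

set_option linter.unusedSimpArgs false in
-- A crossing acts on (p, q) by an elementary matrix. Of the four labelled forms three survive up to
-- sign, and the fourth is replaced by a new one, which `HasLabel.step` controls through the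
-- exchange relation.
theorem HasSlope.cross {n : List ℤ} {j : ℕ} {c : Crossing} (hc : (crossings n)[j]? = some c)
    {κ : ℤˣ} {o : Fin 4 → ℤˣ} {l : Fin 4 → Fin 2} {x : Fin 4 → Fin 2 → ℤ[X]} {p q : ℤ}
    (hx : FormRelations κ o x) (h : HasSlope l x p q) :
    ∃ p' q', HasSlope (cross (fun _ _ x => x) (fun _ => 1) c l) (cross vecAct o c x) p' q' := by
  obtain ⟨hpq, hs, ht, hw, hv, hl0, hl1, hl2⟩ := h
  have hm := hx.mul_middle
  have hl := hx.mul_left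
  have hr := hx.mul_right
  have ho := hx.mul_outer
  obtain ⟨h1, h2, h3⟩ := hx
  have k := unit_cast_sq (R := ℤ[X]) κ
  have e0 := unit_cast_sq (R := ℤ[X]) (o 0)
  have e1 := unit_cast_sq (R := ℤ[X]) (o 1)
  have e2 := unit_cast_sq (R := ℤ[X]) (o 2)
  obtain ⟨α, β, hαβ⟩ := hpq
  have hqp : IsCoprime q p := ⟨β, α, by linarith⟩
  have hpq : IsCoprime p q := ⟨α, β, hαβ⟩
  rcases crossing_cases hc with rfl | rfl | rfl | rfl <;>
  simp only [cross_middle_pos, cross_middle_neg, cross_left_pos, cross_left_neg]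
  · refine ⟨p, p + q, ⟨α - β, β, by linarith⟩, hs.congr ?_ rfl, hw.congr ?_ rfl,
      hs.step hpq ht hw (o 2 * o 1) (o 2 * o 0) (-1) (-o 2) ?_ ?_ ?_,
      (ht.units_mul (κ * o 2)).congr ?_ ?_, ?_, ?_, ?_⟩ <;>
    try simp only [Matrix.cons_val, form_vecAct_left, form_vecAct_right, form_self, Units.val_neg,
      Units.val_mul, Units.val_one, Int.cast_one, Int.cast_mul, Int.cast_neg,
      form_swap (x 1) (x 2), form_swap (x 0) (x 1)]
    all_goals first
      | omega
      | linear_combination hm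
      | linear_combination hl
      | linear_combination hr
      | linear_combination ho
      | (clear hm hl hr ho; grind)
  · refine ⟨p, q - p, ⟨α + β, β, by linarith⟩, hs.congr ?_ rfl,
      (hv.units_mul (κ * o 1)).congr ?_ ?_, ht.congr ?_ ?_,
      hs.step (hpq.neg_right) (ht.congr rfl ?_) hv (κ * o 1) (κ * o 0) (-(κ * o 2)) (-o 1) ?_ ?_ ?_,
      ?_, ?_, ?_⟩ <;>
    try simp only [Matrix.cons_val, form_vecAct_left, form_vecAct_right, form_self, Units.val_neg,
      Units.val_mul, Units.val_one, Int.cast_one, Int.cast_mul, Int.cast_neg,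
      form_swap (x 1) (x 2), form_swap (x 0) (x 1)]
    all_goals first
      | omega
      | linear_combination hm
      | linear_combination hl
      | linear_combination hr
      | linear_combination ho
      | (clear hm hl hr ho; grind)
  · refine ⟨p - q, q, ⟨α, α + β, by linarith⟩, (hv.units_mul (κ * o 1)).congr ?_ rfl,
      ht.congr ?_ rfl, hs.congr ?_ ?_,
      ht.step (hqp.neg_right) (hs.congr rfl ?_) (hv.congr rfl ?_) (κ * o 1) (κ * o 2) (-(κ * o 0))
        (-o 1) ?_ ?_ ?_, ?_, ?_, ?_⟩ <;>
    try simp only [Matrix.cons_val, form_vecAct_left, form_vecAct_right, form_self, Units.val_neg,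
      Units.val_mul, Units.val_one, Int.cast_one, Int.cast_mul, Int.cast_neg,
      form_swap (x 1) (x 2), form_swap (x 0) (x 1)]
    all_goals first
      | omega
      | linear_combination hm
      | linear_combination hl
      | linear_combination hr
      | linear_combination ho
      | (clear hm hl hr ho; grind)
  · refine ⟨p + q, q, ⟨α, β - α, by linarith⟩, hw.congr ?_ rfl,
      ht.congr ?_ rfl,
      ht.step hqp hs (hw.congr rfl ?_) (o 0 * o 1) (o 0 * o 2) (-1) (-o 0) ?_ ?_ ?_,
      (hs.units_mul (κ * o 0)).congr ?_ ?_, ?_, ?_, ?_⟩ <;>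
    try simp only [Matrix.cons_val, form_vecAct_left, form_vecAct_right, form_self, Units.val_neg,
      Units.val_mul, Units.val_one, Int.cast_one, Int.cast_mul, Int.cast_neg,
      form_swap (x 1) (x 2), form_swap (x 0) (x 1)]
    all_goals first
      | omega
      | linear_combination hm
      | linear_combination hl
      | linear_combination hr
      | linear_combination ho
      | (clear hm hl hr ho; grind)

theorem exists_hasSlope (n : List ℤ) {o : Fin 4 → ℤˣ} (ho : ∀ p, o (topMate p) = -o p) (j : ℕ) :
    ∃ p q, HasSlope (carry n ![0, 0, 1, 1] j) (arcVec n o X j) p q := by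
  induction j with
  | zero =>
    have hX : HasLabel (X : ℤ[X]) 1 := ⟨by simp, fun _ => by simp [UnitLead], dvd_rfl⟩
    have h0 : HasLabel (0 : ℤ[X]) 0 := ⟨by simp, fun h => absurd rfl h, dvd_zero _⟩
    refine ⟨1, 0, isCoprime_one_left, ?_, ?_, ?_, ?_, ?_, ?_, ?_⟩ <;>
      simp [arcVec, form, carry, hX, h0]
  | succ j ih =>
    cases hc : (crossings n)[j]? with
    | none => rwa [carry_succ_none _ hc, arcVec_succ_none _ _ hc]
    | some c =>
      rw [carry_succ_some _ hc, arcVec_succ_some _ _ hc]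
      obtain ⟨p, q, h⟩ := ih
      exact h.cross hc (formRelations_arcVec n ho X j)

/-- Up to sign the closing polynomial is t or s, with label q or p. For a knot the strand joined to
strand 3 hangs from the other bridge, so the parity conditions exclude the label 0. -/
theorem closingPoly_ne_zero_and_isUnit_leadingCoeff {n : List ℤ} (hK : IsKnot n) {o : Fin 4 → ℤˣ}
    (ho : ∀ p, o (topMate p) = -o p) :
    closingPoly n o ≠ 0 ∧ IsUnit (closingPoly n o).leadingCoeff := by
  obtain ⟨p, q, h⟩ := exists_hasSlope n ho (height n)
  have hR := formRelations_arcVec n ho (X : ℤ[X]) (height n)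
  suffices ∃ m, m ≠ 0 ∧ HasLabel (closingPoly n o) m by
    obtain ⟨m, hm, hl⟩ := this
    exact ⟨(hl.lead hm).ne_zero, (hl.lead hm).2⟩
  have hk := hK 3
  unfold closingPoly
  unfold bottomMate at hk ⊢
  split_ifs at hk ⊢ with hn
  · refine ⟨q, ?_, (h.left.units_mul (o 0 * carry n o (height n) 2)).congr ?_ rfl⟩
    · rintro rfl
      exact hk (h.parity_two.2 (by simp))
    · simpa using hR.right
  · refine ⟨p, ?_, (h.middle.units_mul (o 0 * carry n o (height n) 0)).congr ?_ rfl⟩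
    · rintro rfl
      exact hk (h.parity_zero.2 (by simp))
    · simpa using hR.outer

theorem isIntegral_of_aeval_repPoly {n : List ℤ} (hK : IsKnot n) {o : Fin 4 → ℤˣ}
    (ho : ∀ p, o (topMate p) = -o p) {r : ℂ} (h : aeval r (repPoly n o) = 0) :
    IsIntegral ℤ r ∧ aeval r (closingPoly n o) = 0 := by
  obtain ⟨h0, h1⟩ := closingPoly_ne_zero_and_isUnit_leadingCoeff hK ho
  -- A leading coefficient ±1 is its own sign and its own inverse: multiplying by it makes the
  -- polynomial monic, and multiplying once more undoes this.
  have hs : (closingPoly n o).leadingCoeff.sign = (closingPoly n o).leadingCoeff := by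
    rcases Int.isUnit_iff.1 h1 with h | h <;> rw [h] <;> rfl
  have hu : (closingPoly n o).leadingCoeff * (closingPoly n o).leadingCoeff = 1 := by
    rcases Int.isUnit_iff.1 h1 with h | h <;> rw [h] <;> rfl
  refine ⟨⟨repPoly n o, ?_, by simpa [aeval_def] using h⟩, ?_⟩
  · rw [repPoly, hs, Monic, leadingCoeff_mul, leadingCoeff_C, hu]
  · rw [repPoly, hs] at h
    have := congrArg (fun z => ((closingPoly n o).leadingCoeff : ℂ) * z) h
    simpa [← mul_assoc, ← Int.cast_mul, hu] using this

end Degrees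

/-! ### Matching of the arc vectors at the bottom -/

section Closing

theorem eq_of_form_eq {K : Type*} [Field K] {x x' y z : Fin 2 → K} (h : form y z ≠ 0)
    (hy : form x y = form x' y) (hz : form x z = form x' z) : x = x' := by
  funext i
  -- Cramer's rule: the expansion of v in the basis y, z.
  have key (v : Fin 2 → K) : form y z * v i = form v z * y i - form v y * z i := by
    fin_cases i <;> simp [form] <;> ring
  exact mul_left_cancel₀ h (by rw [key, key, hy, hz])

theorem eq_or_eq_neg_of_form {K : Type*} [Field K] {x y z : Fin 2 → K} (h : form y z ≠ 0)
    (hy : form x y = 0) (hz : form x z ^ 2 = form y z ^ 2) : x = y ∨ x = -y := by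
  have hn (v : Fin 2 → K) : form (-y) v = -form y v := by simp [form]; ring
  rcases sq_eq_sq_iff_eq_or_eq_neg.1 hz with hz | hz
  · exact Or.inl (eq_of_form_eq h (by rw [hy, form_self]) hz)
  · exact Or.inr (eq_of_form_eq h (by rw [hy, hn, form_self, neg_zero]) (by rw [hz, hn]))

theorem aeval_closingPoly (n : List ℤ) (o : Fin 4 → ℤˣ) (r : ℂ) :
    aeval r (closingPoly n o) =
      form (arcVec n o r (height n) (bottomMate n 3)) (arcVec n o r (height n) 3) := by
  have h := arcVec_map (aeval r : ℤ[X] →ₐ[ℤ] ℂ).toRingHom n o X (height n)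
  have hX : (aeval r : ℤ[X] →ₐ[ℤ] ℂ).toRingHom X = r := aeval_X r
  rw [hX] at h
  rw [← h, ← h]
  simp [closingPoly, form]

/-- The root kills t or s. As joined strands run in opposite directions, the signs in the diagonal
and Plücker relations then make w² and v² equal to the square of the other form, which is nonzero by
`forms_ne_zero`. Each pair of joined vectors is thus proportional with factor ±1. -/
theorem arcVec_bottomMate {n : List ℤ} {o : Fin 4 → ℤˣ} (ho : IsOrientation n o) {r : ℂ}
    (hr : r ≠ 0) (h : aeval r (closingPoly n o) = 0) (p : Fin 4) :
    arcVec n o r (height n) (bottomMate n p) = arcVec n o r (height n) p ∨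
      arcVec n o r (height n) (bottomMate n p) = -arcVec n o r (height n) p := by
  rw [aeval_closingPoly] at h
  have hR := formRelations_arcVec n ho.1 r (height n)
  have hne := forms_ne_zero n o hr (height n)
  have hor := ho.2
  set x := arcVec n o r (height n)
  set e := carry n o (height n)
  have hP := hR.plucker
  have hneg {y z : Fin 2 → ℂ} (h : y = z ∨ y = -z) : z = y ∨ z = -y :=
    h.imp Eq.symm fun h => by rw [h, neg_neg]
  obtain ⟨h1, h2, h3⟩ := hR
  have k := unit_cast_sq (R := ℂ) (o 0)
  have e0 := unit_cast_sq (R := ℂ) (e 0)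
  have e1 := unit_cast_sq (R := ℂ) (e 1)
  have e2 := unit_cast_sq (R := ℂ) (e 2)
  unfold bottomMate at h hor ⊢
  split_ifs at h hor ⊢
  · have h01 : e 1 = -e 0 := by simpa using hor 0
    have h' : form (x 2) (x 3) = 0 := by simpa using h
    have ht : form (x 0) (x 1) = 0 := by grind
    have h01' : ((e 1 : ℤ) : ℂ) = -((e 0 : ℤ) : ℂ) := by rw [h01]; simp
    have hw : form (x 0) (x 2) ^ 2 = form (x 1) (x 2) ^ 2 := by
      rw [ht] at hP h3
      grind
    have hv : form (x 1) (x 3) ^ 2 = form (x 1) (x 2) ^ 2 := by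
      rw [ht] at h3
      grind
    have hs : form (x 1) (x 2) ≠ 0 := fun hs => hne ⟨hs, ht, by simpa [hs] using hw⟩
    have h10 := eq_or_eq_neg_of_form hs ht hw
    have h32 : x 3 = x 2 ∨ x 3 = -x 2 := by
      refine eq_or_eq_neg_of_form (z := x 1) ?_ ?_ ?_
      · rwa [form_swap, neg_ne_zero]
      · rw [form_swap, h', neg_zero]
      · rw [form_swap, neg_sq, hv, form_swap (x 1) (x 2), neg_sq]
    fin_cases p
    · exact hneg h10
    · exact h10
    · exact h32
    · exact hneg h32
  · have h12 : e 1 = -e 2 := by simpa using hor 2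
    have h' : form (x 0) (x 3) = 0 := by simpa using h
    have hs : form (x 1) (x 2) = 0 := by grind
    have h12' : ((e 1 : ℤ) : ℂ) = -((e 2 : ℤ) : ℂ) := by rw [h12]; simp
    have hw : form (x 0) (x 2) ^ 2 = form (x 0) (x 1) ^ 2 := by
      rw [hs] at hP h3
      grind
    have hv : form (x 1) (x 3) ^ 2 = form (x 0) (x 1) ^ 2 := by
      rw [hs] at h3
      grind
    have ht : form (x 0) (x 1) ≠ 0 := fun ht => hne ⟨hs, ht, by simpa [ht] using hw⟩
    have h21 : x 2 = x 1 ∨ x 2 = -x 1 := by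
      refine eq_or_eq_neg_of_form (z := x 0) ?_ ?_ ?_
      · rwa [form_swap, neg_ne_zero]
      · rw [form_swap, hs, neg_zero]
      · rw [form_swap, neg_sq, hw, form_swap (x 0) (x 1), neg_sq]
    have h30 : x 3 = x 0 ∨ x 3 = -x 0 := by
      refine eq_or_eq_neg_of_form (z := x 1) ht ?_ ?_
      · rw [form_swap, h', neg_zero]
      · rw [form_swap, neg_sq, hv]
    fin_cases p
    · exact h30
    · exact h21
    · exact hneg h21
    · exact hneg h30

end Closing

/-! ### The parabolic representation and its image -/

section Representation

open Matrix MatrixGroups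

theorem parabolicMatrix_eq (v : Fin 2 → ℂ) :
    parabolicMatrix v = !![1 - v 0 * v 1, v 0 ^ 2; -v 1 ^ 2, 1 + v 0 * v 1] := by
  ext i j
  fin_cases i <;> fin_cases j <;> simp [parabolicMatrix] <;> ring

/-- `parabolicMatrix` with values in the special linear group. -/
noncomputable def parabolicSL (v : Fin 2 → ℂ) : SL(2, ℂ) :=
  ⟨parabolicMatrix v, by rw [parabolicMatrix_eq, det_fin_two_of]; ring⟩

theorem parabolicSL_neg (v : Fin 2 → ℂ) : parabolicSL (-v) = parabolicSL v :=
  Subtype.ext (by simp [parabolicSL, parabolicMatrix_eq])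

/-- The matrix of v is the transvection w ↦ w + ⟨v, w⟩ v, and conjugating it by g in SL(2) gives the
transvection of g v. -/
theorem parabolicSL_vecAct (ε : ℤˣ) (y x : Fin 2 → ℂ) :
    parabolicSL (vecAct ε y x) = conjAct ε (parabolicSL y) (parabolicSL x) := by
  rcases Int.units_eq_one_or ε with rfl | rfl
  · rw [conjAct, mul_assoc]
    simp only [Units.val_one, _root_.zpow_neg, zpow_one]
    rw [eq_inv_mul_iff_mul_eq]
    refine Subtype.ext ?_
    change parabolicMatrix _ * parabolicMatrix _ = parabolicMatrix _ * parabolicMatrix _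
    simp only [parabolicMatrix_eq]
    ext i j
    fin_cases i <;> fin_cases j <;> simp [vecAct, form] <;> ring
  · rw [conjAct]
    simp only [Units.val_neg, Units.val_one, _root_.zpow_neg, zpow_one, inv_inv]
    rw [eq_mul_inv_iff_mul_eq]
    refine Subtype.ext ?_
    change parabolicMatrix _ * parabolicMatrix _ = parabolicMatrix _ * parabolicMatrix _
    simp only [parabolicMatrix_eq]
    ext i j
    fin_cases i <;> fin_cases j <;> simp [vecAct, form] <;> ring

theorem map_conjAct {G H : Type*} [Group G] [Group H] (φ : G →* H) (ε : ℤˣ) (y x : G) :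
    φ (conjAct ε y x) = conjAct ε (φ y) (φ x) := by
  simp [conjAct]

theorem lift_wirtingerRels {n : List ℤ} {o : Fin 4 → ℤˣ} (ho : IsOrientation n o) {r : ℂ}
    (hr : r ≠ 0) (h : aeval r (closingPoly n o) = 0) :
    ∀ x ∈ wirtingerRels n o,
      FreeGroup.lift (fun s : Seg n => parabolicSL (arcVec n o r s.1 s.2)) x = 1 := by
  rintro x ((⟨p, rfl⟩ | ⟨j, p, rfl⟩) | ⟨p, rfl⟩)
  · simp only [map_mul, map_inv, FreeGroup.lift_apply_of, mul_inv_eq_one]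
    fin_cases p <;> simp [topMate, arcVec]
  · rw [map_mul, map_inv, mul_inv_eq_one, cross_map (act' := conjAct) _ (map_conjAct _)]
    simp only [FreeGroup.lift_apply_of, Fin.val_succ, Fin.val_castSucc]
    have hc : (crossings n)[(j : ℕ)]? = some ((crossings n).get j) :=
      List.getElem?_eq_getElem j.2
    rw [arcVec_succ_some _ _ hc, cross_map (act' := conjAct) _ parabolicSL_vecAct]
  · simp only [map_mul, map_inv, FreeGroup.lift_apply_of, mul_inv_eq_one, Fin.val_last]
    rcases arcVec_bottomMate ho hr h p with h | h <;> simp only [h, parabolicSL_neg]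

theorem existsUnique_correspondsTo {n : List ℤ} {o : Fin 4 → ℤˣ} (ho : IsOrientation n o) {r : ℂ}
    (hr : r ≠ 0) (h : aeval r (closingPoly n o) = 0) :
    ∃! ρ : KnotGroup n o →* SL(2, ℂ), CorrespondsTo n o r ρ := by
  refine ⟨PresentedGroup.toGroup (lift_wirtingerRels ho hr h), fun s => ?_, fun ρ hρ => ?_⟩
  · rw [meridian, PresentedGroup.toGroup.of]
    rfl
  · refine PresentedGroup.ext fun s => Subtype.ext ?_
    rw [PresentedGroup.toGroup.of]
    exact hρ s

theorem meridian_topMate (n : List ℤ) (o : Fin 4 → ℤˣ) (p : Fin 4) :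
    meridian n o (0, topMate p) = meridian n o (0, p) :=
  mul_inv_eq_one.1 (PresentedGroup.one_of_mem (Or.inl (Or.inl ⟨p, rfl⟩)))

theorem meridian_bottomMate (n : List ℤ) (o : Fin 4 → ℤˣ) (p : Fin 4) :
    meridian n o (Fin.last _, bottomMate n p) = meridian n o (Fin.last _, p) :=
  mul_inv_eq_one.1 (PresentedGroup.one_of_mem (Or.inr ⟨p, rfl⟩))

theorem meridian_succ (n : List ℤ) (o : Fin 4 → ℤˣ) (j : Fin (height n)) (p : Fin 4) :
    meridian n o (j.succ, p) = cross conjAct (carry n o j) ((crossings n).get j)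
      (fun q => meridian n o (j.castSucc, q)) p := by
  have h : (PresentedGroup.mk (wirtingerRels n o)) (FreeGroup.of (j.succ, p) *
    (cross conjAct (carry n o j) ((crossings n).get j)
      (fun q => FreeGroup.of (j.castSucc, q)) p)⁻¹) = 1 :=
    PresentedGroup.one_of_mem (Or.inl (Or.inr ⟨j, p, rfl⟩))
  rw [map_mul, map_inv, mul_inv_eq_one, cross_map (act' := conjAct) _ (map_conjAct _)] at h
  exact h

theorem isConj_conjAct {G : Type*} [Group G] (ε : ℤˣ) (y x : G) : IsConj x (conjAct ε y x) := by
  rw [isConj_iff]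
  exact ⟨y ^ (-(ε : ℤ)), by rw [conjAct, _root_.zpow_neg, inv_inv]⟩

/-- The segment at the top of a bridge. -/
def bridge (n : List ℤ) (l : Fin 2) : Seg n := (0, ![0, 2] l)

/-- Passing under a strand conjugates a meridian, so only the bridge from which the strand hangs
matters. -/
theorem isConj_meridian (n : List ℤ) (o : Fin 4 → ℤˣ) (j : Fin (height n + 1)) (p : Fin 4) :
    IsConj (meridian n o (bridge n (carry n ![0, 0, 1, 1] j p))) (meridian n o (j, p)) := by
  induction j using Fin.induction generalizing p with
  | zero =>
    have h0 := meridian_topMate n o 0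
    have h2 := meridian_topMate n o 2
    simp only [topMate, cons_val] at h0 h2
    fin_cases p
    · exact IsConj.refl _
    · exact h0 ▸ IsConj.refl _
    · exact IsConj.refl _
    · exact h2 ▸ IsConj.refl _
  | succ j ih =>
    have hc : (crossings n)[(j : ℕ)]? = some ((crossings n).get j) :=
      List.getElem?_eq_getElem j.2
    rw [meridian_succ, Fin.val_succ, carry_succ_some _ hc]
    simp only [Fin.val_castSucc] at ih
    unfold cross
    split_ifs
    all_goals first | exact ih _ | exact (ih _).trans (isConj_conjAct _ _ _)

theorem isConj_bridges {n : List ℤ} (hK : IsKnot n) (o : Fin 4 → ℤˣ) :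
    IsConj (meridian n o (0, 0)) (meridian n o (0, 2)) := by
  have h1 := isConj_meridian n o (Fin.last _) 0
  have h2 := isConj_meridian n o (Fin.last _) (bottomMate n 0)
  have h := hK 0
  rw [meridian_bottomMate] at h2
  rw [Fin.val_last] at h1 h2
  have h3 := h1.trans h2.symm
  obtain ⟨a, ha⟩ : ∃ a, a = carry n (![0, 0, 1, 1] : Fin 4 → Fin 2) (height n) 0 := ⟨_, rfl⟩
  obtain ⟨b, hb⟩ : ∃ b, b = carry n (![0, 0, 1, 1] : Fin 4 → Fin 2) (height n) (bottomMate n 0) :=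
    ⟨_, rfl⟩
  rw [← ha, ← hb] at h h3
  rcases (show (a = 0 ∧ b = 1) ∨ (a = 1 ∧ b = 0) by omega) with ⟨rfl, rfl⟩ | ⟨rfl, rfl⟩
  · exact h3
  · exact h3.symm

/-- If `ρ` sends the meridians of the two bridges into a subgroup then `ρ` has its values in this
subgroup. -/
theorem apply_mem_of_bridges {n : List ℤ} {o : Fin 4 → ℤˣ} {H : Type*} [Group H]
    (ρ : KnotGroup n o →* H) {S : Subgroup H} (h0 : ρ (meridian n o (0, 0)) ∈ S)
    (h2 : ρ (meridian n o (0, 2)) ∈ S) (γ : KnotGroup n o) : ρ γ ∈ S := by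
  have key (j : Fin (height n + 1)) (p : Fin 4) : ρ (meridian n o (j, p)) ∈ S := by
    induction j using Fin.induction generalizing p with
    | zero =>
      have h0' := meridian_topMate n o 0
      have h2' := meridian_topMate n o 2
      simp only [topMate, cons_val] at h0' h2'
      fin_cases p
      · exact h0
      · exact h0' ▸ h0
      · exact h2
      · exact h2' ▸ h2
    | succ j ih =>
      rw [meridian_succ, cross_map (act' := conjAct) ρ (map_conjAct ρ)]
      unfold cross
      split_ifs
      all_goals first
        | exact ih _
        | exact S.mul_mem (S.mul_mem (S.zpow_mem (ih _) _) (ih _)) (S.zpow_mem (ih _) _)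
  have : (⊤ : Subgroup (KnotGroup n o)) ≤ S.comap ρ := by
    rw [← PresentedGroup.closure_range_of, Subgroup.closure_le]
    rintro _ ⟨s, rfl⟩
    exact key s.1 s.2
  exact this (Subgroup.mem_top γ)

/-- The matrices in `SL(2, ℂ)` with entries in a subring. -/
def slSubring (S : Subring ℂ) : Subgroup SL(2, ℂ) :=
  (SpecialLinearGroup.map (n := Fin 2) S.subtype).range

theorem mem_slSubring {S : Subring ℂ} {g : SL(2, ℂ)} : g ∈ slSubring S ↔ ∀ i j, g i j ∈ S := by
  constructor
  · rintro ⟨g, rfl⟩ i j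
    exact (g i j).2
  · intro h
    refine ⟨⟨Matrix.of fun i j => ⟨g i j, h i j⟩, Subtype.ext ?_⟩, ?_⟩
    · have := g.det_coe
      rw [det_fin_two] at this ⊢
      simpa using this
    · ext i j
      rfl

variable {n : List ℤ} {o : Fin 4 → ℤˣ} {r : ℂ} {ρ : KnotGroup n o →* SL(2, ℂ)}

theorem CorrespondsTo.apply_bridge_zero (h : CorrespondsTo n o r ρ) :
    (ρ (meridian n o (0, 0)) : Matrix (Fin 2) (Fin 2) ℂ) = !![1, 1; 0, 1] := by
  rw [h, parabolicMatrix_eq]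
  simp [arcVec]

theorem CorrespondsTo.apply_bridge_two (h : CorrespondsTo n o r ρ) :
    (ρ (meridian n o (0, 2)) : Matrix (Fin 2) (Fin 2) ℂ) = !![1, 0; -r ^ 2, 1] := by
  rw [h, parabolicMatrix_eq]
  simp [arcVec]

theorem CorrespondsTo.apply_mem_closure (h : CorrespondsTo n o r ρ) (γ : KnotGroup n o)
    (i j : Fin 2) : ρ γ i j ∈ Subring.closure {r ^ 2} := by
  refine mem_slSubring.1 (apply_mem_of_bridges ρ ?_ ?_ γ) i j <;> rw [mem_slSubring]
  · intro i j
    rw [h.apply_bridge_zero]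
    fin_cases i <;> fin_cases j <;> simp [zero_mem, one_mem]
  · intro i j
    rw [h.apply_bridge_two]
    have hm := Subring.subset_closure (Set.mem_singleton (r ^ 2))
    fin_cases i <;> fin_cases j <;> simp [zero_mem, one_mem, -SetLike.mem_coe]
    exact hm

/-- As the meridians of the two bridges are conjugate, `r` is invertible in `ℤ[r²]` up to the
factor `r²`. -/
theorem CorrespondsTo.exists_mul_eq_one (h : CorrespondsTo n o r ρ) (hK : IsKnot n) :
    ∃ d ∈ Subring.closure {r ^ 2}, r * d = 1 := by
  obtain ⟨γ, hγ⟩ := isConj_iff.1 (isConj_bridges hK o)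
  rw [mul_inv_eq_iff_eq_mul] at hγ
  have hg : (ρ γ).val * !![1, 1; 0, 1] = !![1, 0; -r ^ 2, 1] * (ρ γ).val := by
    rw [← h.apply_bridge_zero, ← h.apply_bridge_two]
    have := congrArg ρ hγ
    rw [map_mul, map_mul] at this
    exact congrArg Subtype.val this
  have hd := (ρ γ).det_coe
  rw [det_fin_two] at hd
  -- With g = `ρ γ`, these entries give g₀₀ = 0 and g₁₀ = -r² g₀₁, so det g = 1 reads (r g₀₁)² = 1.
  have h01 := congrFun (congrFun hg 0) 1
  have h11 := congrFun (congrFun hg 1) 1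
  simp [mul_apply, Fin.sum_univ_two] at h01 h11
  have hm := h.apply_mem_closure γ 0 1
  have hsq : (r * ρ γ 0 1) ^ 2 = 1 := by
    linear_combination hd - h01 * ρ γ 1 1 + h11 * ρ γ 0 1
  rcases sq_eq_one_iff.1 hsq with h1 | h1
  · exact ⟨_, hm, h1⟩
  · exact ⟨_, neg_mem hm, by rw [mul_neg, h1, neg_neg]⟩

theorem CorrespondsTo.traceField_eq (h : CorrespondsTo n o r ρ) :
    traceField ρ = IntermediateField.adjoin ℚ {r ^ 2} := by
  apply le_antisymm
  · refine IntermediateField.adjoin_le_iff.2 ?_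
    rintro _ ⟨γ, rfl⟩
    have hle : Subring.closure {r ^ 2} ≤ (IntermediateField.adjoin ℚ {r ^ 2}).toSubring := by
      rw [Subring.closure_le]
      exact IntermediateField.subset_adjoin ℚ _
    rw [trace_fin_two]
    exact add_mem (hle (h.apply_mem_closure γ 0 0)) (hle (h.apply_mem_closure γ 1 1))
  · refine IntermediateField.adjoin_le_iff.2 ?_
    rintro _ rfl
    have hm : ((ρ (meridian n o (0, 0))).val * (ρ (meridian n o (0, 2))).val).trace ∈
        traceField ρ :=
      IntermediateField.subset_adjoin ℚ _ ⟨meridian n o (0, 0) * meridian n o (0, 2), by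
        rw [map_mul]; rfl⟩
    rw [h.apply_bridge_zero, h.apply_bridge_two] at hm
    have h2 : r ^ 2 =
        2 - (!![1, 1; 0, 1] * !![1, 0; -r ^ 2, 1] : Matrix (Fin 2) (Fin 2) ℂ).trace := by
      simp [trace_fin_two]
      ring
    rw [SetLike.mem_coe, h2]
    exact sub_mem (ofNat_mem _ 2) hm

end Representation

end TwoBridge

/-! ### The main theorem -/

theorem proposition5p2 (n : List ℤ) (hn : ∀ m ∈ n, m ≠ 0) (hK : TwoBridge.IsKnot n)
    (o : Fin 4 → ℤˣ) (ho : TwoBridge.IsOrientation n o)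
    (r : ℂ) (hr : r ≠ 0) (hroot : Polynomial.aeval r (TwoBridge.repPoly n o) = 0) :
    (∃! ρ : TwoBridge.KnotGroup n o →* Matrix.SpecialLinearGroup (Fin 2) ℂ,
      TwoBridge.CorrespondsTo n o r ρ) ∧
    ∀ ρ : TwoBridge.KnotGroup n o →* Matrix.SpecialLinearGroup (Fin 2) ℂ,
      TwoBridge.CorrespondsTo n o r ρ →
        TwoBridge.traceField ρ = IntermediateField.adjoin ℚ {r ^ 2} ∧
        r ∈ TwoBridge.traceField ρ ∧
        ∃ ε : (NumberField.RingOfIntegers (TwoBridge.traceField ρ))ˣ,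
          (((ε : NumberField.RingOfIntegers (TwoBridge.traceField ρ)) :
            TwoBridge.traceField ρ) : ℂ) = r := by
  obtain ⟨hint, hclose⟩ := TwoBridge.isIntegral_of_aeval_repPoly hK ho.1 hroot
  refine ⟨TwoBridge.existsUnique_correspondsTo ho hr hclose, fun ρ hρ => ?_⟩
  obtain ⟨d, hd, hrd⟩ := hρ.exists_mul_eq_one hK
  have hle : Subring.closure {r ^ 2} ≤ (TwoBridge.traceField ρ).toSubring := by
    rw [Subring.closure_le, hρ.traceField_eq]
    exact IntermediateField.subset_adjoin ℚ _
  have hleInt : Subring.closure {r ^ 2} ≤ (integralClosure ℤ ℂ).toSubring := by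
    rw [Subring.closure_le, Set.singleton_subset_iff]
    exact hint.pow 2
  have hdK : d ∈ TwoBridge.traceField ρ := hle hd
  have hrK : r ∈ TwoBridge.traceField ρ := by
    rw [← inv_eq_of_mul_eq_one_left hrd]
    exact inv_mem hdK
  refine ⟨hρ.traceField_eq, hrK, ?_⟩
  have hinj : Function.Injective (algebraMap (TwoBridge.traceField ρ) ℂ) :=
    (algebraMap (TwoBridge.traceField ρ) ℂ).injective
  have hr' : IsIntegral ℤ (⟨r, hrK⟩ : TwoBridge.traceField ρ) :=
    (isIntegral_algebraMap_iff hinj).1 hint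
  -- The inverse d of r is integral because it lies in ℤ[r²].
  have hd' : IsIntegral ℤ (⟨d, hdK⟩ : TwoBridge.traceField ρ) :=
    (isIntegral_algebraMap_iff hinj).1 (hleInt hd)
  refine ⟨⟨⟨⟨r, hrK⟩, hr'⟩, ⟨⟨d, hdK⟩, hd'⟩, ?_, ?_⟩, rfl⟩
  · exact NumberField.RingOfIntegers.ext (Subtype.ext hrd)
  · exact NumberField.RingOfIntegers.ext (Subtype.ext ((mul_comm d r).trans hrd))
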